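/- Let $H$ be a real or complex Hilbert space and let $\varphi : H \to H$ be a bounded linear operator. For $k \ge 1$ let $H^{\otimes k}$ be the $k$-fold algebraic tensor power of $H$. Its injective norm is $$\|z\|_\varepsilon = \sup\{ |\langle f_1 \otimes \cdots \otimes f_k, z\rangle| : f_1,\dots,f_k \in H^*,\ \|f_i\| \le 1 \},$$ and $\|z\|_h = \langle z,z\rangle^{1/2}$ is the norm of the canonical inner product determined by $\langle x_1\otimes\cdots\otimes x_k, y_1\otimes\cdots\otimes y_k\rangle = \prod_i \langle x_i,y_i\rangle$. Let $$\|\varphi^{\otimes k}\|_{\varepsilon\to h} = \sup\{\|\varphi^{\otimes k}(z)\|_h : z \in H^{\otimes k},\ \|z\|_\varepsilon \le 1\} \in [0,\infty].$$ Let $\mathrm{hs}(\varphi) = \left(\sum_{i} \|\varphi(e_i)\|^2\right)^{1/2} \in [0,\infty]$, where $(e_i)$ is any orthonormal basis of $H$; $\varphi$ is Hilbert--Schmidt if this is finite for some orthonormal basis. Let $\pi_2(\varphi)$ be the $2$-summing norm, i.e. the infimum (equal to $+\infty$ if there is none) of the constants $0 \le C<\infty$ such that $$\left(\sum_{i=1}^n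 \|\varphi(x_i)\|^2\right)^{1/2} \le C \sup_{f \in H^*,\ \|f\|\le 1} \left(\sum_{i=1}^n |f(x_i)|^2\right)^{1/2}$$ for all finite families $x_1,\dots,x_n$ in $H$. Then the limit below exists in $[0,\infty]$ and, for every choice of the orthonormal basis used to compute $\mathrm{hs}(\varphi)$, $$\lim_{k\to\infty} \|\varphi^{\otimes k}\|_{\varepsilon\to h}^{1/k} = \mathrm{hs}(\varphi) = \pi_2(\varphi).$$ In particular, the limit is finite if and only if $\varphi$ is Hilbert--Schmidt. -/

import Mathlib

open Filter Topology
open scoped TensorProduct ENNReal NNReal ComplexConjugate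

namespace TensorPowerNorms

section Injective

variable {𝕜 X : Type*} [RCLike 𝕜] [NormedAddCommGroup X] [NormedSpace 𝕜 X]

/-- The product functional `f₁ ⊗ ⋯ ⊗ f_k` on the algebraic tensor power `X^{⊗ k}`,
`x₁ ⊗ ⋯ ⊗ x_k ↦ f₁ x₁ ⋯ f_k x_k`. -/
noncomputable def productFunctional {k : ℕ} (f : Fin k → StrongDual 𝕜 X) :
    (⨂[𝕜]^k X) →ₗ[𝕜] 𝕜 :=
  PiTensorProduct.dualDistrib (⨂ₜ[𝕜] i, ((f i : X →L[𝕜] 𝕜) : X →ₗ[𝕜] 𝕜))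

theorem productFunctional_tprod {k : ℕ} (f : Fin k → StrongDual 𝕜 X) (x : Fin k → X) :
    productFunctional f (⨂ₜ[𝕜] i, x i) = ∏ i, f i (x i) := by
  simp [productFunctional]

/-- The injective norm of a tensor `z` in the algebraic tensor power `X^{⊗ k}`: the supremum of
`|⟨f₁ ⊗ ⋯ ⊗ f_k, z⟩|` over functionals `f₁, …, f_k` in the closed unit ball of the dual of `X`. -/
noncomputable def injNorm {k : ℕ} (z : ⨂[𝕜]^k X) : ℝ≥0∞ :=
  ⨆ (f : Fin k → StrongDual 𝕜 X) (_ : ∀ i, ‖f i‖ ≤ 1), ‖productFunctional f z‖ₑ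

end Injective

section Hilbert

variable {𝕜 H : Type*} [RCLike 𝕜] [NormedAddCommGroup H] [InnerProductSpace 𝕜 H]

/-- For fixed `y₁, …, y_k`, the linear functional `x₁ ⊗ ⋯ ⊗ x_k ↦ ∏ i, ⟪y i, x i⟫`. -/
noncomputable def innerFunctional {k : ℕ} (y : Fin k → H) : (⨂[𝕜]^k H) →ₗ[𝕜] 𝕜 :=
  productFunctional fun i => innerSL 𝕜 (y i)

theorem innerFunctional_tprod {k : ℕ} (y x : Fin k → H) :
    innerFunctional y (⨂ₜ[𝕜] i, x i) = ∏ i, inner 𝕜 (y i) (x i) := by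
  simp [innerFunctional, productFunctional_tprod]

/-- The antilinear functional `z ↦ conj (innerFunctional y z)`, that is,
`x₁ ⊗ ⋯ ⊗ x_k ↦ ∏ i, ⟪x i, y i⟫`. -/
noncomputable def innerAntiFunctional {k : ℕ} (y : Fin k → H) : (⨂[𝕜]^k H) →ₗ⋆[𝕜] 𝕜 where
  toFun z := conj (innerFunctional y z)
  map_add' := by simp
  map_smul' := by simp

theorem innerAntiFunctional_tprod {k : ℕ} (y x : Fin k → H) :
    innerAntiFunctional y (⨂ₜ[𝕜] i, x i) = ∏ i, inner 𝕜 (x i) (y i) := by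
  change conj (innerFunctional y (⨂ₜ[𝕜] i, x i)) = _
  simp [innerFunctional_tprod]

theorem anti_ext {k : ℕ} {f g : (⨂[𝕜]^k H) →ₗ⋆[𝕜] 𝕜}
    (h : ∀ x : Fin k → H, f (⨂ₜ[𝕜] i, x i) = g (⨂ₜ[𝕜] i, x i)) : f = g := by
  ext z
  induction z using PiTensorProduct.induction_on with
  | smul_tprod r x => simp [h]
  | add a b ha hb => simp [ha, hb]

/-- The canonical sesquilinear form on the algebraic tensor power `H^{⊗ k}` of an inner product
space; it is linear in the first and antilinear in the second argument of this bundled map, and is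
determined by `innerAux (y₁ ⊗ ⋯ ⊗ y_k) (x₁ ⊗ ⋯ ⊗ x_k) = ∏ i, ⟪x i, y i⟫`. -/
noncomputable def innerAux (k : ℕ) : (⨂[𝕜]^k H) →ₗ[𝕜] ((⨂[𝕜]^k H) →ₗ⋆[𝕜] 𝕜) :=
  PiTensorProduct.lift
    { toFun := fun y => innerAntiFunctional y
      map_update_add' := by
        intro _ y i a b
        refine anti_ext fun x => ?_
        rw [LinearMap.add_apply]
        simp only [innerAntiFunctional_tprod]
        rw [← Finset.mul_prod_erase _ _ (Finset.mem_univ i),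
          ← Finset.mul_prod_erase _ (fun j => inner 𝕜 (x j) (Function.update y i a j))
            (Finset.mem_univ i),
          ← Finset.mul_prod_erase _ (fun j => inner 𝕜 (x j) (Function.update y i b j))
            (Finset.mem_univ i)]
        simp only [Function.update_self, inner_add_right, add_mul]
        congr 2 <;>
        · refine Finset.prod_congr rfl fun j hj => ?_
          simp [Function.update_of_ne (Finset.ne_of_mem_erase hj)]
      map_update_smul' := by
        intro _ y i c a
        refine anti_ext fun x => ?_
        rw [LinearMap.smul_apply]
        simp only [innerAntiFunctional_tprod]
        rw [← Finset.mul_prod_erase _ _ (Finset.mem_univ i),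
          ← Finset.mul_prod_erase _ (fun j => inner 𝕜 (x j) (Function.update y i a j))
            (Finset.mem_univ i)]
        simp only [Function.update_self, inner_smul_right, smul_eq_mul, mul_assoc]
        congr 2
        refine Finset.prod_congr rfl fun j hj => ?_
        simp [Function.update_of_ne (Finset.ne_of_mem_erase hj)] }

/-- The canonical inner product on the algebraic tensor power `H^{⊗ k}`, antilinear in the first
and linear in the second argument. -/
noncomputable def tensorInner {k : ℕ} (z w : ⨂[𝕜]^k H) : 𝕜 := innerAux k w z

theorem tensorInner_tprod {k : ℕ} (x y : Fin k → H) :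
    tensorInner (⨂ₜ[𝕜] i, x i) (⨂ₜ[𝕜] i, y i) = ∏ i, inner 𝕜 (x i) (y i) := by
  rw [tensorInner, innerAux, PiTensorProduct.lift.tprod]
  exact innerAntiFunctional_tprod y x

/-- The Hilbert space norm `⟪z, z⟫^{1/2}` of a tensor `z ∈ H^{⊗ k}`. -/
noncomputable def hilbertNorm {k : ℕ} (z : ⨂[𝕜]^k H) : ℝ≥0∞ :=
  ENNReal.ofReal (Real.sqrt (RCLike.re (tensorInner z z)))

end Hilbert

section Operators

variable {𝕜 X Y H : Type*} [RCLike 𝕜] [NormedAddCommGroup X] [NormedSpace 𝕜 X]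
  [NormedAddCommGroup Y] [NormedSpace 𝕜 Y] [NormedAddCommGroup H] [InnerProductSpace 𝕜 H]

/-- The tensor power `φ^{⊗ k} : X^{⊗ k} → Y^{⊗ k}`. -/
noncomputable def tensorPowerMap (φ : X →L[𝕜] Y) (k : ℕ) : (⨂[𝕜]^k X) →ₗ[𝕜] (⨂[𝕜]^k Y) :=
  PiTensorProduct.map fun _ => (φ : X →ₗ[𝕜] Y)

/-- `‖φ^{⊗ k}‖_{ε → h}`: the operator norm (possibly `∞`) of `φ^{⊗ k}` from `X^{⊗ k}` with the
injective norm to `H^{⊗ k}` with the Hilbert space norm. -/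
noncomputable def normInjToHilbert (φ : X →L[𝕜] H) (k : ℕ) : ℝ≥0∞ :=
  ⨆ (z : ⨂[𝕜]^k X) (_ : injNorm z ≤ 1), hilbertNorm (tensorPowerMap φ k z)

/-- `C` is a `2`-summing constant for `φ`: for all finite families `(x_i)` in `X`,
`(∑ ‖φ x_i‖²)^{1/2} ≤ C * sup_{‖f‖ ≤ 1} (∑ |f x_i|²)^{1/2}`. -/
def IsTwoSummingConst (φ : X →L[𝕜] Y) (C : ℝ≥0) : Prop :=
  ∀ (n : ℕ) (x : Fin n → X),
    (∑ i, ‖φ (x i)‖ₑ ^ 2) ^ (1 / 2 : ℝ) ≤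
      (C : ℝ≥0∞) * ⨆ (f : StrongDual 𝕜 X) (_ : ‖f‖ ≤ 1), (∑ i, ‖f (x i)‖ₑ ^ 2) ^ (1 / 2 : ℝ)

/-- The `2`-summing norm `π₂(φ)`, equal to `∞` if `φ` is not `2`-summing. -/
noncomputable def twoSummingNorm (φ : X →L[𝕜] Y) : ℝ≥0∞ :=
  ⨅ (C : ℝ≥0) (_ : IsTwoSummingConst φ C), (C : ℝ≥0∞)

/-- The Hilbert–Schmidt norm `(∑ ‖φ e_i‖²)^{1/2}` (possibly `∞`), computed in the orthonormal
(Hilbert) basis `e`. -/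
noncomputable def hsNorm {ι : Type*} (e : HilbertBasis ι 𝕜 H) (φ : H →L[𝕜] Y) : ℝ≥0∞ :=
  (∑' i, ‖φ (e i)‖ₑ ^ 2) ^ (1 / 2 : ℝ)

/-- `φ` is Hilbert–Schmidt: `∑ ‖φ e_i‖² < ∞` for some orthonormal (Hilbert) basis `e`. -/
def IsHilbertSchmidt (φ : H →L[𝕜] Y) : Prop :=
  ∃ (s : Set H) (e : HilbertBasis s 𝕜 H), Summable fun i => ‖φ (e i)‖ ^ 2

end Operators

end TensorPowerNorms

/-! On the span F of finitely many vectors, a singular basis u makes the φ(u_j) orthogonal, so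
‖φ^{⊗k} z‖_h² = ∑_J |c_J|² ∏ ‖φ(u_{J_i})‖² for z = ∑_J c_J u_J in F^{⊗k}.

Upper bound (`normInjToHilbert_le`): each c_J is a product functional at z, so ‖z‖_ε ≤ 1 gives |c_J|
≤ 1, and the sum is at most (∑_j ‖φ(u_j)‖²)^k ≤ hs(φ)^{2k}.

Lower bound (`exists_flat_tensor`): with c_J = ±1 the h-norm is the full (∑_j ‖φ(u_j)‖²)^{k/2}. The
injective norm only has to be tested on k-tuples from a finite δ-net, at a loss of (1-δ)^{-k}. There
are exponentially many such tuples, so the exponential moment bound yields signs with all values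
O(k). Taking k-th roots, letting δ → 0 and F grow gives hs(φ).

For π₂ = hs, finite parts of a basis test the 2-summing inequality from below, and the singular
basis proves it from above. -/

namespace TensorPowerNorms

/-! ### Hilbert–Schmidt sums and singular bases. -/

section HilbertSchmidt

variable {𝕜 E G : Type*} [RCLike 𝕜] [NormedAddCommGroup E] [InnerProductSpace 𝕜 E]
  [NormedAddCommGroup G] [InnerProductSpace 𝕜 G]

theorem sqrt_pow_eq_pow_sqrt {x : ℝ} (hx : 0 ≤ x) (k : ℕ) : √(x ^ k) = √x ^ k := by
  rw [Real.sqrt_eq_rpow, Real.sqrt_eq_rpow, ← Real.rpow_natCast_mul hx,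
    ← Real.rpow_mul_natCast hx, mul_comm]

theorem enorm_sq_eq_ofReal {X : Type*} [SeminormedAddCommGroup X] (x : X) :
    ‖x‖ₑ ^ 2 = ENNReal.ofReal (‖x‖ ^ 2) := by
  rw [ENNReal.ofReal_pow (norm_nonneg x), ofReal_norm]

theorem sum_enorm_sq_eq_ofReal {X ι : Type*} [SeminormedAddCommGroup X] (s : Finset ι)
    (x : ι → X) : ∑ i ∈ s, ‖x i‖ₑ ^ 2 = ENNReal.ofReal (∑ i ∈ s, ‖x i‖ ^ 2) := by
  rw [ENNReal.ofReal_sum_of_nonneg fun i _ => by positivity]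
  exact Finset.sum_congr rfl fun i _ => enorm_sq_eq_ofReal _

theorem tsum_enorm_inner_sq {ι : Type*} (b : HilbertBasis ι 𝕜 E) (x : E) :
    ∑' i, ‖inner 𝕜 (b i) x‖ₑ ^ 2 = ‖x‖ₑ ^ 2 := by
  have h := RCLike.hasSum_re 𝕜 (b.hasSum_inner_mul_inner x x)
  have h' : HasSum (fun i => ‖inner 𝕜 (b i) x‖ ^ 2) (‖x‖ ^ 2) := by
    rw [← inner_self_eq_norm_sq (𝕜 := 𝕜)]
    convert h using 2 with i
    rw [← inner_conj_symm x, RCLike.conj_mul]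
    norm_cast
  simp_rw [enorm_sq_eq_ofReal]
  rw [← ENNReal.ofReal_tsum_of_nonneg (fun i => by positivity) h'.summable, h'.tsum_eq]

theorem tsum_enorm_inner_sq_le {ι : Type*} {v : ι → E} (hv : Orthonormal 𝕜 v) (x : E) :
    ∑' i, ‖inner 𝕜 (v i) x‖ₑ ^ 2 ≤ ‖x‖ₑ ^ 2 := by
  rw [ENNReal.tsum_eq_iSup_sum]
  refine iSup_le fun s => ?_
  rw [sum_enorm_sq_eq_ofReal, enorm_sq_eq_ofReal]
  exact ENNReal.ofReal_le_ofReal (hv.sum_inner_products_le x)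

/-- An orthonormal family gives at most the Hilbert–Schmidt sum of a Hilbert basis. -/
theorem tsum_enorm_sq_le_of_orthonormal [CompleteSpace E] [CompleteSpace G] {ι κ : Type*}
    (T : E →L[𝕜] G) {v : κ → E} (hv : Orthonormal 𝕜 v) (e : HilbertBasis ι 𝕜 E) :
    ∑' j, ‖T (v j)‖ₑ ^ 2 ≤ ∑' i, ‖T (e i)‖ₑ ^ 2 := by
  obtain ⟨w, b, -⟩ := exists_hilbertBasis 𝕜 G
  have key : ∀ (a : w) (x : E),
      ‖inner 𝕜 (b a) (T x)‖ₑ = ‖inner 𝕜 x (ContinuousLinearMap.adjoint T (b a))‖ₑ := by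
    intro a x
    rw [← ContinuousLinearMap.adjoint_inner_left, ← inner_conj_symm, RCLike.enorm_conj]
  -- Parseval in `b` and exchange of sums turn both sides into sums over `a` of coefficients of `T*
  -- (b a)`: Bessel applies to `v`, Parseval to `e`.
  simp_rw [← tsum_enorm_inner_sq b, key]
  rw [ENNReal.tsum_comm, ENNReal.tsum_comm (f := fun (i : ι) (a : w) =>
    ‖inner 𝕜 (e i) (ContinuousLinearMap.adjoint T (b a))‖ₑ ^ 2)]
  simp_rw [tsum_enorm_inner_sq e]
  exact ENNReal.tsum_le_tsum fun a => tsum_enorm_inner_sq_le hv _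

/-- Singular value decomposition: a finite-dimensional subspace has an orthonormal basis which a
given operator maps to an orthogonal family. -/
theorem exists_orthonormal_image_orthogonal [CompleteSpace G] (T : E →L[𝕜] G) (F : Submodule 𝕜 E)
    [FiniteDimensional 𝕜 F] :
    ∃ (n : ℕ) (u : OrthonormalBasis (Fin n) 𝕜 F),
      ∀ i j, i ≠ j → inner 𝕜 (T (u i)) (T (u j)) = 0 := by
  have : CompleteSpace F := FiniteDimensional.complete 𝕜 F
  let S : F →L[𝕜] G := T.comp F.subtypeL
  have hsym : ((ContinuousLinearMap.adjoint S ∘L S : F →L[𝕜] F) : F →ₗ[𝕜] F).IsSymmetric := by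
    intro x y
    exact (ContinuousLinearMap.adjoint_inner_left S _ _).trans
      (ContinuousLinearMap.adjoint_inner_right S _ _).symm
  -- Eigenvectors of `S* S`: ⟨S u_i, S u_j⟩ = ⟨u_i, S* S u_j⟩ is a multiple of ⟨u_i, u_j⟩.
  refine ⟨_, hsym.eigenvectorBasis rfl, fun i j hij => ?_⟩
  have h1 := hsym.apply_eigenvectorBasis rfl j
  have h2 : inner 𝕜 (S (hsym.eigenvectorBasis rfl i)) (S (hsym.eigenvectorBasis rfl j)) =
      inner 𝕜 (hsym.eigenvectorBasis rfl i)
        (((ContinuousLinearMap.adjoint S ∘L S : F →L[𝕜] F) : F →ₗ[𝕜] F)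
          (hsym.eigenvectorBasis rfl j)) := by
    exact (ContinuousLinearMap.adjoint_inner_right S _ _).symm
  rw [h1, inner_smul_right, (hsym.eigenvectorBasis rfl).orthonormal.2 hij, mul_zero] at h2
  exact h2

end HilbertSchmidt

/-! ### Coordinates of tensors and the upper bound. -/

section Tensors

variable {𝕜 H : Type*} [RCLike 𝕜] [NormedAddCommGroup H] [InnerProductSpace 𝕜 H]

/-- The square of the Hilbert norm of a combination of elementary tensors of orthogonal vectors. -/
theorem hilbertNorm_sum_smul_tprod {n k : ℕ} {w : Fin n → H}
    (hw : ∀ i j, i ≠ j → inner 𝕜 (w i) (w j) = 0) (c : (Fin k → Fin n) → 𝕜) :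
    hilbertNorm (∑ J, c J • ⨂ₜ[𝕜] i, w (J i)) =
      ENNReal.ofReal (√(∑ J, ‖c J‖ ^ 2 * ∏ i, ‖w (J i)‖ ^ 2)) := by
  have hin : ∀ J L : Fin k → Fin n, innerAux (𝕜 := 𝕜) k (⨂ₜ[𝕜] i, w (L i)) (⨂ₜ[𝕜] i, w (J i)) =
      if J = L then ∏ i, ((‖w (J i)‖ ^ 2 : ℝ) : 𝕜) else 0 := by
    intro J L
    have := tensorInner_tprod (𝕜 := 𝕜) (fun i => w (J i)) (fun i => w (L i))
    rw [tensorInner] at this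
    rw [this]
    split_ifs with h
    · subst h
      refine Finset.prod_congr rfl fun i _ => ?_
      rw [inner_self_eq_norm_sq_to_K]; norm_cast
    · obtain ⟨i, hi⟩ := Function.ne_iff.mp h
      exact Finset.prod_eq_zero (Finset.mem_univ i) (hw _ _ hi)
  rw [hilbertNorm, tensorInner]
  congr 2
  simp only [map_sum, LinearMap.sum_apply, map_smul, LinearMap.smul_apply, LinearMap.map_smulₛₗ,
    hin, smul_eq_mul, mul_ite, mul_zero, Finset.sum_ite_eq, Finset.mem_univ,
    if_true]
  refine Finset.sum_congr rfl fun J _ => ?_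
  rw [← mul_assoc, RCLike.conj_mul]
  norm_cast

/-- Algebraic tensors involve finitely many vectors; this reduction makes a singular basis available
without compactness of the operator. -/
theorem exists_finiteDimensional_mem_span {k : ℕ} (z : ⨂[𝕜]^k H) :
    ∃ F : Submodule 𝕜 H, FiniteDimensional 𝕜 F ∧
      z ∈ Submodule.span 𝕜 {t | ∃ x : Fin k → H, (∀ i, x i ∈ F) ∧ t = ⨂ₜ[𝕜] i, x i} := by
  induction z using PiTensorProduct.induction_on with
  | smul_tprod r x =>
    refine ⟨Submodule.span 𝕜 (Set.range x),
      FiniteDimensional.span_of_finite 𝕜 (Set.finite_range x), Submodule.smul_mem _ _ ?_⟩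
    exact Submodule.subset_span ⟨x, fun i => Submodule.subset_span ⟨i, rfl⟩, rfl⟩
  | add a b ha hb =>
    obtain ⟨F, hF, ha⟩ := ha
    obtain ⟨F', hF', hb⟩ := hb
    refine ⟨F ⊔ F', inferInstance, Submodule.add_mem _ ?_ ?_⟩
    · refine Submodule.span_mono ?_ ha
      rintro t ⟨x, hx, rfl⟩
      exact ⟨x, fun i => Submodule.mem_sup_left (hx i), rfl⟩
    · refine Submodule.span_mono ?_ hb
      rintro t ⟨x, hx, rfl⟩
      exact ⟨x, fun i => Submodule.mem_sup_right (hx i), rfl⟩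

theorem eq_sum_innerFunctional_smul {k n : ℕ} {F : Submodule 𝕜 H}
    (u : OrthonormalBasis (Fin n) 𝕜 F) {z : ⨂[𝕜]^k H}
    (hz : z ∈ Submodule.span 𝕜 {t | ∃ x : Fin k → H, (∀ i, x i ∈ F) ∧ t = ⨂ₜ[𝕜] i, x i}) :
    z = ∑ J : Fin k → Fin n,
      innerFunctional (𝕜 := 𝕜) (fun i => (u (J i) : H)) z • ⨂ₜ[𝕜] i, (u (J i) : H) := by
  induction hz using Submodule.span_induction with
  | mem t ht =>
    obtain ⟨x, hx, rfl⟩ := ht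
    have hexp : ∀ i, x i = ∑ j, inner 𝕜 (u j : H) (x i) • (u j : H) := fun i => by
      simpa using (congrArg Subtype.val (u.sum_repr' ⟨x i, hx i⟩)).symm
    simp_rw [innerFunctional_tprod, ← MultilinearMap.map_smul_univ]
    rw [← MultilinearMap.map_sum (PiTensorProduct.tprod 𝕜)
      (fun i j => inner 𝕜 (u j : H) (x i) • (u j : H))]
    congr 1
    exact funext hexp
  | zero => simp
  | add a b _ _ ha hb =>
    nth_rewrite 1 [ha, hb]
    simp only [map_add, add_smul, Finset.sum_add_distrib]
  | smul r a _ ha =>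
    nth_rewrite 1 [ha]
    simp only [map_smul, smul_assoc, Finset.smul_sum]

theorem enorm_productFunctional_le_injNorm {X : Type*} [NormedAddCommGroup X] [NormedSpace 𝕜 X]
    {k : ℕ} (z : ⨂[𝕜]^k X) (f : Fin k → StrongDual 𝕜 X) (hf : ∀ i, ‖f i‖ ≤ 1) :
    ‖productFunctional f z‖ₑ ≤ injNorm z :=
  le_iSup₂ (f := fun (f : Fin k → StrongDual 𝕜 X) (_ : ∀ i, ‖f i‖ ≤ 1) =>
    ‖productFunctional f z‖ₑ) f hf

theorem tensorPowerMap_sum_smul_tprod {Y : Type*} [NormedAddCommGroup Y] [NormedSpace 𝕜 Y]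
    (φ : H →L[𝕜] Y) {k n : ℕ} (u : Fin n → H) (c : (Fin k → Fin n) → 𝕜) :
    tensorPowerMap φ k (∑ J, c J • ⨂ₜ[𝕜] i, u (J i)) = ∑ J, c J • ⨂ₜ[𝕜] i, φ (u (J i)) := by
  simp [tensorPowerMap]

/-- `‖φ^{⊗ k}‖_{ε → h} ≤ hs(φ) ^ k`. -/
theorem normInjToHilbert_le [CompleteSpace H] {G : Type*} [NormedAddCommGroup G]
    [InnerProductSpace 𝕜 G] [CompleteSpace G] (φ : H →L[𝕜] G)
    {ι : Type*} (e : HilbertBasis ι 𝕜 H) (k : ℕ) :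
    normInjToHilbert φ k ≤ hsNorm e φ ^ k := by
  refine iSup₂_le fun z hz => ?_
  obtain ⟨F, hF, hzF⟩ := exists_finiteDimensional_mem_span z
  obtain ⟨n, u, hu⟩ := exists_orthonormal_image_orthogonal φ F
  have hu1 : Orthonormal 𝕜 (fun i => (u i : H)) := u.orthonormal.comp_linearIsometry F.subtypeₗᵢ
  rw [eq_sum_innerFunctional_smul u hzF,
    tensorPowerMap_sum_smul_tprod φ (fun j => (u j : H)),
    hilbertNorm_sum_smul_tprod hu]
  set c := fun J : Fin k → Fin n => innerFunctional (𝕜 := 𝕜) (fun i => (u (J i) : H)) z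
  have hc : ∀ J, ‖c J‖ ≤ 1 := by
    intro J
    have h := (enorm_productFunctional_le_injNorm z (fun i => innerSL 𝕜 (u (J i) : H))
      fun i => by rw [innerSL_apply_norm]; exact (hu1.1 _).le).trans hz
    rw [← ofReal_norm, ENNReal.ofReal_le_one] at h
    exact h
  have h1 : ∑ J, ‖c J‖ ^ 2 * ∏ i, ‖φ (u (J i))‖ ^ 2 ≤ (∑ j, ‖φ (u j)‖ ^ 2) ^ k := by
    rw [Fintype.sum_pow]
    refine Finset.sum_le_sum fun J _ => mul_le_of_le_one_left (by positivity) ?_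
    exact pow_le_one₀ (norm_nonneg _) (hc J)
  have h2 : ENNReal.ofReal (∑ j, ‖φ (u j)‖ ^ 2) ≤ ∑' i, ‖φ (e i)‖ₑ ^ 2 := by
    rw [← sum_enorm_sq_eq_ofReal, ← tsum_fintype (L := .unconditional _)]
    exact tsum_enorm_sq_le_of_orthonormal φ hu1 e
  calc _ ≤ ENNReal.ofReal (√((∑ j, ‖φ (u j)‖ ^ 2) ^ k)) :=
        ENNReal.ofReal_le_ofReal (Real.sqrt_le_sqrt h1)
    _ = (ENNReal.ofReal (∑ j, ‖φ (u j)‖ ^ 2) ^ (1 / 2 : ℝ)) ^ k := by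
        have : 0 ≤ ∑ j, ‖φ (u j)‖ ^ 2 := by positivity
        rw [ENNReal.ofReal_rpow_of_nonneg this (by norm_num), ← Real.sqrt_eq_rpow,
          ← ENNReal.ofReal_pow (Real.sqrt_nonneg _), sqrt_pow_eq_pow_sqrt this]
    _ ≤ _ := by
        unfold hsNorm
        gcongr

end Tensors

/-! ### Hilbert–Schmidt norm equals 2-summing norm. -/

section TwoSumming

variable {𝕜 H G : Type*} [RCLike 𝕜] [NormedAddCommGroup H] [InnerProductSpace 𝕜 H]
  [CompleteSpace H] [NormedAddCommGroup G] [InnerProductSpace 𝕜 G]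

theorem sum_enorm_dual_sq_le {ι : Type*} [Fintype ι] {v : ι → H} (hv : Orthonormal 𝕜 v)
    (f : StrongDual 𝕜 H) (hf : ‖f‖ ≤ 1) : ∑ i, ‖f (v i)‖ₑ ^ 2 ≤ 1 := by
  have h := tsum_enorm_inner_sq_le hv ((InnerProductSpace.toDual 𝕜 H).symm f)
  have key : ∀ i, ‖inner 𝕜 (v i) ((InnerProductSpace.toDual 𝕜 H).symm f)‖ₑ = ‖f (v i)‖ₑ := by
    intro i
    rw [← inner_conj_symm, RCLike.enorm_conj, InnerProductSpace.toDual_symm_apply]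
  simp_rw [key] at h
  rw [tsum_fintype] at h
  refine h.trans (pow_le_one₀ zero_le ?_)
  rw [← ofReal_norm, LinearIsometryEquiv.norm_map]
  exact ENNReal.ofReal_le_one.2 hf

/-- Finite subfamilies of `e` have weak 2-norm at most 1 by Bessel, so they serve as test families.
-/
theorem hsNorm_le_of_isTwoSummingConst {Y : Type*} [NormedAddCommGroup Y] [NormedSpace 𝕜 Y]
    {φ : H →L[𝕜] Y} {C : ℝ≥0} (hC : IsTwoSummingConst φ C)
    {ι : Type*} (e : HilbertBasis ι 𝕜 H) : hsNorm e φ ≤ C := by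
  have h2 : ∑' i, ‖φ (e i)‖ₑ ^ 2 ≤ (C : ℝ≥0∞) ^ (2 : ℝ) := by
    rw [ENNReal.tsum_eq_iSup_sum]
    refine iSup_le fun s => ?_
    have hv : Orthonormal 𝕜 (fun j : Fin s.card => e (s.equivFin.symm j)) :=
      e.orthonormal.comp _ (Subtype.val_injective.comp s.equivFin.symm.injective)
    have h := hC s.card fun j => e (s.equivFin.symm j)
    have hsum : ∑ j : Fin s.card, ‖φ (e (s.equivFin.symm j))‖ₑ ^ 2 = ∑ i ∈ s, ‖φ (e i)‖ₑ ^ 2 := by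
      rw [Equiv.sum_comp s.equivFin.symm (fun i : s => ‖φ (e i)‖ₑ ^ 2),
        Finset.sum_coe_sort s (fun i => ‖φ (e i)‖ₑ ^ 2)]
    rw [hsum] at h
    have hb : (∑ i ∈ s, ‖φ (e i)‖ₑ ^ 2) ^ (1 / 2 : ℝ) ≤ C := by
      refine h.trans (mul_le_of_le_one_right' (iSup₂_le fun f hf => ?_))
      exact ENNReal.rpow_le_one (sum_enorm_dual_sq_le hv f hf) (by norm_num)
    rwa [one_div, ENNReal.rpow_inv_le_iff (by norm_num)] at hb
  rw [hsNorm, one_div, ← ENNReal.le_rpow_inv_iff (by norm_num), inv_inv]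
  exact h2

/-- In a singular basis u of the span of the x_i, Pythagoras gives ∑_i ‖φ x_i‖² = ∑_j ‖φ u_j‖² ∑_i
|⟨u_j, x_i⟩|². Each inner sum is at most `W`², as ⟨u_j, ·⟩ lies in the dual unit ball. -/
theorem isTwoSummingConst_of_hsNorm_eq [CompleteSpace G] {φ : H →L[𝕜] G} {C : ℝ≥0}
    {ι : Type*} (e : HilbertBasis ι 𝕜 H) (hC : hsNorm e φ = C) : IsTwoSummingConst φ C := by
  intro n x
  set W := ⨆ (f : StrongDual 𝕜 H) (_ : ‖f‖ ≤ 1), (∑ i, ‖f (x i)‖ₑ ^ 2) ^ (1 / 2 : ℝ) with hW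
  let F := Submodule.span 𝕜 (Set.range x)
  have : FiniteDimensional 𝕜 F := FiniteDimensional.span_of_finite 𝕜 (Set.finite_range x)
  obtain ⟨m, u, hu⟩ := exists_orthonormal_image_orthogonal φ F
  have hu1 : Orthonormal 𝕜 (fun i => (u i : H)) := u.orthonormal.comp_linearIsometry F.subtypeₗᵢ
  have hexp : ∀ i, φ (x i) = ∑ j, inner 𝕜 (u j : H) (x i) • φ (u j) := fun i => by
    have : x i = ∑ j, inner 𝕜 (u j : H) (x i) • (u j : H) := by
      simpa using (congrArg Subtype.val
        (u.sum_repr' ⟨x i, Submodule.subset_span ⟨i, rfl⟩⟩)).symm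
    conv_lhs => rw [this]
    simp
  have hpyth : ∀ i, ‖φ (x i)‖ₑ ^ 2 = ∑ j, ‖inner 𝕜 (u j : H) (x i)‖ₑ ^ 2 * ‖φ (u j)‖ₑ ^ 2 := by
    intro i
    simp_rw [← mul_pow, ← enorm_smul]
    rw [sum_enorm_sq_eq_ofReal, enorm_sq_eq_ofReal, hexp]
    congr 1
    rw [← inner_self_eq_norm_sq (𝕜 := 𝕜), sum_inner, map_sum]
    refine Finset.sum_congr rfl fun j _ => ?_
    rw [inner_sum, Finset.sum_eq_single j, inner_self_eq_norm_sq]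
    · intro l _ hl
      rw [inner_smul_left, inner_smul_right, hu _ _ hl.symm]; simp
    · simp
  have hle : ∀ j, ∑ i, ‖inner 𝕜 (u j : H) (x i)‖ₑ ^ 2 ≤ W ^ (2 : ℝ) := by
    intro j
    have h : (∑ i, ‖innerSL 𝕜 (u j : H) (x i)‖ₑ ^ 2) ^ (1 / 2 : ℝ) ≤ W :=
      le_iSup₂ (f := fun (f : StrongDual 𝕜 H) (_ : ‖f‖ ≤ 1) =>
        (∑ i, ‖f (x i)‖ₑ ^ 2) ^ (1 / 2 : ℝ)) (innerSL 𝕜 (u j : H))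
        (by rw [innerSL_apply_norm]; exact (hu1.1 j).le)
    rwa [one_div, ENNReal.rpow_inv_le_iff (by norm_num)] at h
  have hhs : ∑ j, ‖φ (u j)‖ₑ ^ 2 ≤ ∑' i, ‖φ (e i)‖ₑ ^ 2 := by
    rw [← tsum_fintype (L := .unconditional _)]
    exact tsum_enorm_sq_le_of_orthonormal φ hu1 e
  have hmain : ∑ i, ‖φ (x i)‖ₑ ^ 2 ≤ (∑' i, ‖φ (e i)‖ₑ ^ 2) * W ^ (2 : ℝ) := by
    simp_rw [hpyth]
    rw [Finset.sum_comm]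
    simp_rw [← Finset.sum_mul]
    calc _ ≤ ∑ j, W ^ (2 : ℝ) * ‖φ (u j)‖ₑ ^ 2 := by gcongr with j; exact hle j
      _ = (∑ j, ‖φ (u j)‖ₑ ^ 2) * W ^ (2 : ℝ) := by rw [← Finset.mul_sum, mul_comm]
      _ ≤ _ := by gcongr
  rw [← hC, hsNorm]
  calc _ ≤ ((∑' i, ‖φ (e i)‖ₑ ^ 2) * W ^ (2 : ℝ)) ^ (1 / 2 : ℝ) := by gcongr
    _ = _ := by
      rw [ENNReal.mul_rpow_of_nonneg _ _ (by norm_num), ← ENNReal.rpow_mul]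
      norm_num

theorem hsNorm_eq_twoSummingNorm [CompleteSpace G] (φ : H →L[𝕜] G)
    {ι : Type*} (e : HilbertBasis ι 𝕜 H) : hsNorm e φ = twoSummingNorm φ := by
  refine le_antisymm (le_iInf₂ fun C hC => hsNorm_le_of_isTwoSummingConst hC e) ?_
  rcases eq_or_ne (hsNorm e φ) ∞ with h | h
  · rw [h]; exact le_top
  · lift hsNorm e φ to ℝ≥0 using h with C hC
    exact iInf₂_le C (isTwoSummingConst_of_hsNorm_eq e hC.symm)

end TwoSumming

/-! ### Finite nets and multilinear forms. -/

section Nets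

variable {𝕜 V : Type*} [RCLike 𝕜] [NormedAddCommGroup V] [NormedSpace 𝕜 V]

variable (𝕜 V) in
theorem exists_finset_net [FiniteDimensional 𝕜 V] {δ : ℝ} (hδ : 0 < δ) :
    ∃ A : Finset V, (∀ a ∈ A, ‖a‖ ≤ 1) ∧ ∀ f : V, ‖f‖ ≤ 1 → ∃ a ∈ A, ‖f - a‖ ≤ δ := by
  have : ProperSpace V := FiniteDimensional.proper_rclike 𝕜 V
  obtain ⟨t, hts, htf, hcov⟩ := (isCompact_closedBall (0 : V) 1).finite_cover_balls hδ
  refine ⟨htf.toFinset, fun a ha => ?_, fun f hf => ?_⟩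
  · simpa using hts (htf.mem_toFinset.1 ha)
  · obtain ⟨a, ha, hfa⟩ := Set.mem_iUnion₂.1 (hcov (by simpa using hf))
    refine ⟨a, htf.mem_toFinset.2 ha, ?_⟩
    rw [← dist_eq_norm]
    exact (Metric.mem_ball.1 hfa).le

theorem norm_apply_le_of_net {δ : ℝ} (hδ1 : δ < 1) {A : Finset V}
    (hnet : ∀ f : V, ‖f‖ ≤ 1 → ∃ a ∈ A, ‖f - a‖ ≤ δ) (g : V →L[𝕜] 𝕜) {c : ℝ}
    (hg : ∀ a ∈ A, ‖g a‖ ≤ c) {f : V} (hf : ‖f‖ ≤ 1) : ‖g f‖ ≤ c / (1 - δ) := by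
  have key : ∀ f : V, ‖f‖ ≤ 1 → ‖g f‖ ≤ c + ‖g‖ * δ := by
    intro f hf
    obtain ⟨a, ha, hfa⟩ := hnet f hf
    calc ‖g f‖ = ‖g a + g (f - a)‖ := by rw [← map_add]; simp
      _ ≤ ‖g a‖ + ‖g (f - a)‖ := norm_add_le _ _
      _ ≤ c + ‖g‖ * δ := add_le_add (hg a ha) (g.le_opNorm_of_le hfa)
  -- The approximation error involves ‖g‖ itself; solving for it gives ‖g‖ ≤ c / (1 - δ).
  have hn : ‖g‖ ≤ c + ‖g‖ * δ := by
    have h0 : 0 ≤ c + ‖g‖ * δ := (norm_nonneg _).trans (key 0 (by simp))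
    exact g.opNorm_le_of_unit_norm h0 fun x hx => key x hx.le
  rw [le_div_iff₀ (by linarith)]
  have : ‖g f‖ ≤ ‖g‖ := by simpa using g.le_opNorm_of_le hf
  nlinarith

theorem MultilinearMap.norm_apply_le_of_net [FiniteDimensional 𝕜 V] {δ : ℝ} (hδ1 : δ < 1) {A : Finset V}
    (hnet : ∀ f : V, ‖f‖ ≤ 1 → ∃ a ∈ A, ‖f - a‖ ≤ δ) {ι : Type*} [Fintype ι] [DecidableEq ι]
    (m : MultilinearMap 𝕜 (fun _ : ι => V) 𝕜) {c : ℝ}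
    (hm : ∀ v : ι → V, (∀ i, v i ∈ A) → ‖m v‖ ≤ c) {v : ι → V} (hv : ∀ i, ‖v i‖ ≤ 1) :
    ‖m v‖ ≤ c / (1 - δ) ^ Fintype.card ι := by
  -- `s` collects the slots released from the net to the whole ball; each release costs one factor 1
  -- / (1 - δ).
  have key : ∀ s : Finset ι, ∀ v : ι → V, (∀ i ∈ s, ‖v i‖ ≤ 1) → (∀ i ∉ s, v i ∈ A) →
      ‖m v‖ ≤ c / (1 - δ) ^ s.card := by
    intro s
    induction s using Finset.induction_on with
    | empty => intro v _ h; simpa using hm v fun i => h i (by simp)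
    | insert i s hi ih =>
      intro v h1 h2
      have := TensorPowerNorms.norm_apply_le_of_net hδ1 hnet
        (LinearMap.toContinuousLinearMap (m.toLinearMap v i)) (c := c / (1 - δ) ^ s.card)
        (fun a ha => ?_) (h1 i (Finset.mem_insert_self i s))
      · simpa [Finset.card_insert_of_notMem hi, pow_succ, div_div] using this
      · refine ih (Function.update v i a) (fun j hj => ?_) fun j hj => ?_
        · rw [Function.update_of_ne (by rintro rfl; exact hi hj)]
          exact h1 j (Finset.mem_insert_of_mem hj)
        · by_cases hji : j = i
          · subst hji; simpa using ha
          · rw [Function.update_of_ne hji]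
            exact h2 j (by simp [hji, hj])
  exact key Finset.univ v (fun i _ => hv i) (by simp)

end Nets

/-! ### Random signs. -/

section Signs

/-- Some choice of signs makes finitely many signed sums of unit vectors small: the exponential
moment bound for Rademacher sums, at parameter `1`. -/
theorem exists_signs_sum_le {I T : Type*} [Fintype I] [Fintype T] [Nonempty T]
    (a : T → I → ℝ) (ha : ∀ t, ∑ J, a t J ^ 2 ≤ 1) :
    ∃ ε : I → ℝ, (∀ J, |ε J| = 1) ∧
      ∀ t, ∑ J, ε J * a t J ≤ Real.log (Fintype.card T) + 1 / 2 := by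
  classical
  let s : Bool → ℝ := fun b => if b then 1 else -1
  have hmgf : ∀ t, ∑ σ : I → Bool, Real.exp (∑ J, s (σ J) * a t J) ≤
      2 ^ Fintype.card I * Real.exp (1 / 2) := by
    intro t
    simp_rw [Real.exp_sum]
    rw [← Fintype.prod_sum (fun J b => Real.exp (s b * a t J))]
    have h1 : ∀ J, ∑ b, Real.exp (s b * a t J) ≤ 2 * Real.exp (a t J ^ 2 / 2) := by
      intro J
      have := Real.cosh_le_exp_half_sq (a t J)
      rw [Real.cosh_eq] at this
      have hs : ∑ b, Real.exp (s b * a t J) = Real.exp (a t J) + Real.exp (-a t J) := by simp [s]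
      linarith
    calc _ ≤ ∏ J, 2 * Real.exp (a t J ^ 2 / 2) :=
          Finset.prod_le_prod (fun J _ => by positivity) fun J _ => h1 J
      _ = 2 ^ Fintype.card I * Real.exp ((∑ J, a t J ^ 2) / 2) := by
          rw [Finset.prod_mul_distrib, ← Real.exp_sum, Finset.sum_div]; simp
      _ ≤ _ := by
          have := ha t
          gcongr
  have htot : ∑ σ : I → Bool, ∑ t, Real.exp (∑ J, s (σ J) * a t J) ≤
      ∑ _σ : I → Bool, Fintype.card T * Real.exp (1 / 2) := by
    rw [Finset.sum_comm]
    refine (Finset.sum_le_sum fun t _ => hmgf t).trans (le_of_eq ?_)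
    simp
    ring
  -- Some σ does no worse than average; positivity of the exponentials then bounds every single term
  -- by the total.
  obtain ⟨σ, -, hσ⟩ := Finset.exists_le_of_sum_le Finset.univ_nonempty htot
  refine ⟨fun J => s (σ J), fun J => ?_, fun t => ?_⟩
  · simp only [s]; split_ifs <;> simp
  · have h : Real.exp (∑ J, s (σ J) * a t J) ≤ Fintype.card T * Real.exp (1 / 2) :=
      (Finset.single_le_sum (f := fun t => Real.exp (∑ J, s (σ J) * a t J))
        (fun t _ => (Real.exp_pos _).le) (Finset.mem_univ t)).trans hσ
    have hT : (0 : ℝ) < Fintype.card T := by exact_mod_cast Fintype.card_pos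
    rw [← Real.log_exp (∑ J, s (σ J) * a t J)]
    refine (Real.log_le_log (Real.exp_pos _) h).trans (le_of_eq ?_)
    rw [Real.log_mul hT.ne' (Real.exp_pos _).ne', Real.log_exp]

theorem exists_signs_norm_sum_le {𝕜 I T : Type*} [RCLike 𝕜] [Fintype I] [Fintype T] [Nonempty T]
    (a : T → I → 𝕜) (ha : ∀ t, ∑ J, ‖a t J‖ ^ 2 ≤ 1) :
    ∃ ε : I → ℝ, (∀ J, |ε J| = 1) ∧
      ∀ t, ‖∑ J, (ε J : 𝕜) * a t J‖ ≤ 2 * (Real.log (4 * Fintype.card T) + 1 / 2) := by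
  -- One-sided bounds for ± the real and imaginary parts give absolute values, at the price of 4
  -- times as many families.
  let a' : T × Bool × Bool → I → ℝ := fun p J =>
    (if p.2.1 then 1 else -1) * (if p.2.2 then RCLike.re (a p.1 J) else RCLike.im (a p.1 J))
  obtain ⟨ε, hε, h⟩ := exists_signs_sum_le a' fun p => by
    refine (Finset.sum_le_sum fun J _ => ?_).trans (ha p.1)
    have h1 : a' p J ^ 2 =
        (if p.2.2 then RCLike.re (a p.1 J) else RCLike.im (a p.1 J)) ^ 2 := by
      simp only [a']; rw [mul_pow]; split_ifs <;> simp
    rw [h1, ← sq_abs]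
    gcongr
    split_ifs
    · exact RCLike.abs_re_le_norm _
    · exact RCLike.abs_im_le_norm _
  refine ⟨ε, hε, fun t => ?_⟩
  have hcard : (Fintype.card (T × Bool × Bool) : ℝ) = 4 * Fintype.card T := by
    simp [Fintype.card_prod]; ring
  rw [hcard] at h
  have hre : |RCLike.re (∑ J, (ε J : 𝕜) * a t J)| ≤
      Real.log (4 * Fintype.card T) + 1 / 2 := by
    have h1 := h (t, true, true)
    have h2 := h (t, false, true)
    simp only [a', if_true, one_mul, Bool.false_eq_true, if_false, neg_one_mul, mul_neg,
      Finset.sum_neg_distrib] at h1 h2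
    rw [abs_le]
    simp only [map_sum, RCLike.re_ofReal_mul]
    constructor <;> linarith
  have him : |RCLike.im (∑ J, (ε J : 𝕜) * a t J)| ≤
      Real.log (4 * Fintype.card T) + 1 / 2 := by
    have h1 := h (t, true, false)
    have h2 := h (t, false, false)
    simp only [a', if_true, one_mul, Bool.false_eq_true, if_false, neg_one_mul, mul_neg,
      Finset.sum_neg_distrib] at h1 h2
    rw [abs_le]
    simp only [map_sum, RCLike.im_ofReal_mul]
    constructor <;> linarith
  set x := ∑ J, (ε J : 𝕜) * a t J
  calc ‖x‖ ≤ ‖(RCLike.re x : 𝕜)‖ + ‖(RCLike.im x : 𝕜) * RCLike.I‖ := by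
        conv_lhs => rw [← RCLike.re_add_im x]
        exact norm_add_le _ _
    _ ≤ |RCLike.re x| + |RCLike.im x| := by
        rw [norm_mul, RCLike.norm_ofReal, RCLike.norm_ofReal]
        gcongr
        refine mul_le_of_le_one_right (abs_nonneg _) ?_
        rw [RCLike.norm_I]; split_ifs <;> norm_num
    _ ≤ _ := by linarith

end Signs

/-! ### The lower bound and the limit. -/

section LowerBound

variable {𝕜 H G : Type*} [RCLike 𝕜] [NormedAddCommGroup H] [InnerProductSpace 𝕜 H]
  [CompleteSpace H] [NormedAddCommGroup G] [InnerProductSpace 𝕜 G]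

/-- Tensors with unimodular coefficients in an orthonormal basis can have injective norm growing
slower than any given exponential. -/
theorem exists_flat_tensor {n : ℕ} {u : Fin n → H} (hu : Orthonormal 𝕜 u) {δ : ℝ} (hδ : 0 < δ)
    (hδ1 : δ < 1) : ∃ B : ℝ, 0 < B ∧ ∀ k : ℕ, ∃ c : (Fin k → Fin n) → 𝕜,
      (∀ J, ‖c J‖ = (1 - δ) ^ k / (B * (k + 1))) ∧
      injNorm (∑ J, c J • ⨂ₜ[𝕜] i, u (J i)) ≤ 1 := by
  obtain ⟨A, hA1, hnet⟩ := exists_finset_net 𝕜 (EuclideanSpace 𝕜 (Fin n)) hδ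
  have hAne : Nonempty A := by
    obtain ⟨a, ha, -⟩ := hnet 0 (by simp)
    exact ⟨a, ha⟩
  have hN : (1 : ℝ) ≤ Fintype.card A := by exact_mod_cast Fintype.card_pos
  have hlogN : 0 ≤ Real.log (Fintype.card A) := Real.log_nonneg hN
  have hlog4 : 0 ≤ Real.log 4 := Real.log_nonneg (by norm_num)
  -- With N = |A|, log (4 N^k) + 1/2 is affine in k; this `B` dominates it by `B * (k + 1)`, and the
  -- net does not depend on k.
  refine ⟨2 * (Real.log 4 + 1 / 2 + Real.log (Fintype.card A)), by positivity, fun k => ?_⟩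
  set B : ℝ := 2 * (Real.log 4 + 1 / 2 + Real.log (Fintype.card A)) with hB
  have hB0 : 0 < B := by positivity
  obtain ⟨ε, hε, hsum⟩ := exists_signs_norm_sum_le
    (fun (t : Fin k → A) (J : Fin k → Fin n) => ∏ i, (t i : EuclideanSpace 𝕜 (Fin n)) (J i))
    (fun t => by
      simp_rw [norm_prod, ← Finset.prod_pow]
      rw [← Fintype.prod_sum (fun i j => ‖(t i : EuclideanSpace 𝕜 (Fin n)) j‖ ^ 2)]
      refine Finset.prod_le_one (fun i _ => by positivity) fun i _ => ?_
      rw [← EuclideanSpace.norm_sq_eq]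
      exact pow_le_one₀ (norm_nonneg _) (hA1 _ (t i).2))
  have hbound : 2 * (Real.log (4 * Fintype.card (Fin k → A)) + 1 / 2) ≤ B * (k + 1) := by
    rw [Fintype.card_pi_const, Nat.cast_pow, Real.log_mul (by norm_num) (by positivity),
      Real.log_pow]
    have hk : (0 : ℝ) ≤ k := k.cast_nonneg
    rw [hB]
    nlinarith [mul_nonneg hk hlogN, mul_nonneg hk hlog4]
  let m : MultilinearMap 𝕜 (fun _ : Fin k => EuclideanSpace 𝕜 (Fin n)) 𝕜 :=
    ∑ J : Fin k → Fin n, (ε J : 𝕜) • (MultilinearMap.mkPiAlgebra 𝕜 (Fin k) 𝕜).compLinearMap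
      fun i => (EuclideanSpace.proj (J i) : EuclideanSpace 𝕜 (Fin n) →L[𝕜] 𝕜).toLinearMap
  have hm : ∀ v, m v = ∑ J : Fin k → Fin n, (ε J : 𝕜) * ∏ i, v i (J i) := by
    intro v
    simp [m]
  have hm1 : ∀ v : Fin k → EuclideanSpace 𝕜 (Fin n), (∀ i, ‖v i‖ ≤ 1) →
      ‖m v‖ ≤ B * (k + 1) / (1 - δ) ^ k := by
    intro v hv
    have := MultilinearMap.norm_apply_le_of_net hδ1 hnet m (c := B * (k + 1)) (fun v hv => by
      rw [hm]; exact (hsum fun i => ⟨v i, hv i⟩).trans hbound) hv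
    simpa using this
  have hδk : 0 < (1 - δ) ^ k := pow_pos (by linarith) k
  set r : ℝ := (1 - δ) ^ k / (B * (k + 1)) with hr
  have hr0 : 0 < r := by positivity
  refine ⟨fun J => (r : 𝕜) * (ε J : 𝕜), fun J => ?_, iSup₂_le fun f hf => ?_⟩
  · rw [norm_mul, RCLike.norm_ofReal, RCLike.norm_ofReal, hε, mul_one, abs_of_pos hr0]
  · have heq : productFunctional f (∑ J, ((r : 𝕜) * (ε J : 𝕜)) • ⨂ₜ[𝕜] i, u (J i)) =
        (r : 𝕜) * m fun i => WithLp.toLp 2 fun j => f i (u j) := by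
      rw [hm]
      simp [productFunctional_tprod, Finset.mul_sum, mul_assoc]
    -- By Bessel, functionals in the unit ball act on the span of `u` as vectors of the Euclidean
    -- unit ball.
    have hv : ∀ i, ‖(WithLp.toLp 2 fun j => f i (u j) : EuclideanSpace 𝕜 (Fin n))‖ ≤ 1 := by
      intro i
      have h := sum_enorm_dual_sq_le hu (f i) (hf i)
      rw [sum_enorm_sq_eq_ofReal, ENNReal.ofReal_le_one] at h
      rw [← sq_le_one_iff₀ (norm_nonneg _), EuclideanSpace.norm_sq_eq]
      simpa using h
    rw [heq, ← ofReal_norm, ENNReal.ofReal_le_one, norm_mul, RCLike.norm_ofReal, abs_of_pos hr0]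
    calc _ ≤ r * (B * (k + 1) / (1 - δ) ^ k) := by gcongr; exact hm1 _ hv
      _ = 1 := by rw [hr]; field_simp

theorem exists_le_normInjToHilbert (φ : H →L[𝕜] G) {n : ℕ} {u : Fin n → H}
    (hu : Orthonormal 𝕜 u) (hφu : ∀ i j, i ≠ j → inner 𝕜 (φ (u i)) (φ (u j)) = 0)
    {δ : ℝ} (hδ : 0 < δ) (hδ1 : δ < 1) : ∃ B : ℝ, 0 < B ∧ ∀ k : ℕ,
      ENNReal.ofReal ((√(∑ j, ‖φ (u j)‖ ^ 2) * (1 - δ)) ^ k / (B * (k + 1))) ≤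
        normInjToHilbert φ k := by
  obtain ⟨B, hB, h⟩ := exists_flat_tensor hu hδ hδ1
  refine ⟨B, hB, fun k => ?_⟩
  obtain ⟨c, hc, hinj⟩ := h k
  refine le_trans (le_of_eq ?_) (le_iSup₂ (f := fun (z : ⨂[𝕜]^k H) (_ : injNorm z ≤ 1) =>
    hilbertNorm (tensorPowerMap φ k z)) _ hinj)
  have h0 : 0 ≤ (1 - δ) ^ k / (B * (k + 1)) :=
    div_nonneg (pow_nonneg (by linarith) k) (by positivity)
  simp_rw [tensorPowerMap_sum_smul_tprod, hilbertNorm_sum_smul_tprod hφu, hc]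
  rw [← Finset.mul_sum, ← Fintype.sum_pow (fun j => ‖φ (u j)‖ ^ 2), Real.sqrt_mul (by positivity), Real.sqrt_sq h0, mul_pow,
    sqrt_pow_eq_pow_sqrt (by positivity)]
  congr 1
  ring

/-- `‖φ^{⊗ k}‖_{ε → h} ^ (1 / k)` is eventually larger than any number less than `hs(φ)`. -/
theorem eventually_lt_normInjToHilbert_rpow [CompleteSpace G] (φ : H →L[𝕜] G) {ι : Type*}
    (e : HilbertBasis ι 𝕜 H) {b : ℝ≥0∞} (hb : b < hsNorm e φ) :
    ∀ᶠ k : ℕ in atTop, b < normInjToHilbert φ k ^ (1 / (k : ℝ)) := by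
  rw [hsNorm, one_div, ENNReal.lt_rpow_inv_iff (by norm_num), ENNReal.tsum_eq_iSup_sum,
    lt_iSup_iff] at hb
  obtain ⟨s, hs⟩ := hb
  let F := Submodule.span 𝕜 (Set.range fun i : s => e i)
  have : FiniteDimensional 𝕜 F := FiniteDimensional.span_of_finite 𝕜 (Set.finite_range _)
  have : CompleteSpace F := FiniteDimensional.complete 𝕜 F
  obtain ⟨n, u, hu⟩ := exists_orthonormal_image_orthogonal φ F
  have hu1 : Orthonormal 𝕜 (fun i => (u i : H)) := u.orthonormal.comp_linearIsometry F.subtypeₗᵢ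
  have hle : ∑ i ∈ s, ‖φ (e i)‖ₑ ^ 2 ≤ ENNReal.ofReal (∑ j, ‖φ (u j)‖ ^ 2) := by
    have hv : Orthonormal 𝕜 (fun i : s => (⟨e i, Submodule.subset_span ⟨i, rfl⟩⟩ : F)) := by
      have := e.orthonormal.comp (fun i : s => (i : ι)) Subtype.val_injective
      rwa [← F.subtypeₗᵢ.orthonormal_comp_iff]
    have h := tsum_enorm_sq_le_of_orthonormal (φ.comp F.subtypeL) hv u.toHilbertBasis
    rw [tsum_fintype, tsum_fintype] at h
    rw [← sum_enorm_sq_eq_ofReal, ← Finset.sum_coe_sort s (fun i => ‖φ (e i)‖ₑ ^ 2)]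
    simpa using h
  have hlt := hs.trans_le hle
  set S := ∑ j, ‖φ (u j)‖ ^ 2 with hS
  have hS0 : 0 ≤ S := by positivity
  have hbt : b ≠ ∞ := by rintro rfl; simp at hlt
  lift b to ℝ≥0 using hbt
  have hbS : (b : ℝ) < √S := by
    rw [Real.lt_sqrt b.coe_nonneg]
    rw [ENNReal.rpow_two, ENNReal.lt_ofReal_iff_toReal_lt (by simp)] at hlt
    simpa using hlt
  -- For b < β < ρ < √S, the choice δ = 1 - ρ/√S turns the lower bound into ρ^k / (B(k+1)), and the
  -- gap ρ/β > 1 absorbs the linear factor.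
  obtain ⟨ρ, hbρ, hρS⟩ := exists_between hbS
  obtain ⟨β, hbβ, hβρ⟩ := exists_between hbρ
  have hβ0 : 0 < β := b.2.trans_lt hbβ
  have hρ0 : 0 < ρ := hβ0.trans hβρ
  have hSpos : 0 < √S := hρ0.trans hρS
  obtain ⟨B, hB, h⟩ := exists_le_normInjToHilbert φ hu1 hu (δ := 1 - ρ / √S)
    (by rw [sub_pos, div_lt_one hSpos]; exact hρS) (by rw [sub_lt_self_iff]; positivity)
  rw [sub_sub_cancel, mul_div_cancel₀ _ hSpos.ne'] at h
  have hq : 1 < ρ / β := by rwa [one_lt_div hβ0]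
  have hlim : Tendsto (fun k : ℕ => B * ((k : ℝ) ^ 1 / (ρ / β) ^ k + (k : ℝ) ^ 0 / (ρ / β) ^ k))
      atTop (𝓝 0) := by
    simpa using ((tendsto_pow_const_div_const_pow_of_one_lt 1 hq).add
      (tendsto_pow_const_div_const_pow_of_one_lt 0 hq)).const_mul B
  filter_upwards [hlim.eventually_le_const one_pos, eventually_gt_atTop 0] with k hk hk0
  have hk0' : (0 : ℝ) < k := by exact_mod_cast hk0
  rw [one_div, ENNReal.lt_rpow_inv_iff hk0', ENNReal.rpow_natCast]
  refine lt_of_lt_of_le ?_ (h k)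
  have h1 : β ^ k ≤ ρ ^ k / (B * (k + 1)) := by
    rw [le_div_iff₀ (by positivity)]
    have : B * (k + 1) / (ρ / β) ^ k ≤ 1 := by
      refine le_trans (le_of_eq ?_) hk
      rw [pow_one, pow_zero]; ring
    rw [div_le_one (by positivity), div_pow, le_div_iff₀ (by positivity)] at this
    linarith
  refine lt_of_lt_of_le ?_ (ENNReal.ofReal_le_ofReal h1)
  rw [ENNReal.ofReal_pow hβ0.le]
  refine ENNReal.pow_lt_pow_left hk0.ne' ?_
  rw [ENNReal.lt_ofReal_iff_toReal_lt (by simp)]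
  simpa using hbβ

theorem tendsto_normInjToHilbert_rpow [CompleteSpace G] (φ : H →L[𝕜] G) {ι : Type*}
    (e : HilbertBasis ι 𝕜 H) :
    Tendsto (fun k : ℕ => normInjToHilbert φ k ^ (1 / (k : ℝ))) atTop (𝓝 (hsNorm e φ)) := by
  refine tendsto_order.2 ⟨fun b hb => eventually_lt_normInjToHilbert_rpow φ e hb, fun b hb => ?_⟩
  -- At k = 0 the exponent 1/k is 0 by convention, so that term is discarded.
  filter_upwards [eventually_gt_atTop 0] with k hk
  refine lt_of_le_of_lt ?_ hb
  rw [one_div, ENNReal.rpow_inv_le_iff (by exact_mod_cast hk), ENNReal.rpow_natCast]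
  exact normInjToHilbert_le φ e k

end LowerBound

theorem hsNorm_ne_top_iff {𝕜 H Y : Type*} [RCLike 𝕜] [NormedAddCommGroup H]
    [InnerProductSpace 𝕜 H] [NormedAddCommGroup Y] [NormedSpace 𝕜 Y] (φ : H →L[𝕜] Y)
    {ι : Type*} (e : HilbertBasis ι 𝕜 H) :
    hsNorm e φ ≠ ∞ ↔ Summable fun i => ‖φ (e i)‖ ^ 2 := by
  rw [hsNorm, ne_eq, ENNReal.rpow_eq_top_iff_of_pos (by norm_num)]
  simp_rw [enorm_sq_eq_ofReal]
  refine ⟨fun h => ?_, fun h => h.tsum_ofReal_ne_top⟩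
  refine (ENNReal.summable_toReal h).congr fun i => ?_
  rw [ENNReal.toReal_ofReal (by positivity)]

end TensorPowerNorms

theorem propositionp {𝕜 : Type*} [RCLike 𝕜] {H : Type*} [NormedAddCommGroup H]
    [InnerProductSpace 𝕜 H] [CompleteSpace H] (φ : H →L[𝕜] H) :
    (∀ {ι : Type*} (e : HilbertBasis ι 𝕜 H),
      Tendsto (fun k : ℕ => TensorPowerNorms.normInjToHilbert φ k ^ (1 / (k : ℝ))) atTop
          (𝓝 (TensorPowerNorms.hsNorm e φ)) ∧
        TensorPowerNorms.hsNorm e φ = TensorPowerNorms.twoSummingNorm φ) ∧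
    ((∃ L : ℝ≥0∞, L ≠ ∞ ∧
        Tendsto (fun k : ℕ => TensorPowerNorms.normInjToHilbert φ k ^ (1 / (k : ℝ))) atTop
          (𝓝 L)) ↔
      TensorPowerNorms.IsHilbertSchmidt φ) := by
  refine ⟨fun e => ⟨TensorPowerNorms.tendsto_normInjToHilbert_rpow φ e,
    TensorPowerNorms.hsNorm_eq_twoSummingNorm φ e⟩, ?_, ?_⟩
  · rintro ⟨L, hL, hlim⟩
    obtain ⟨w, b, -⟩ := exists_hilbertBasis 𝕜 H
    rw [tendsto_nhds_unique hlim (TensorPowerNorms.tendsto_normInjToHilbert_rpow φ b),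
      TensorPowerNorms.hsNorm_ne_top_iff] at hL
    exact ⟨w, b, hL⟩
  · rintro ⟨s, e, he⟩
    exact ⟨_, (TensorPowerNorms.hsNorm_ne_top_iff φ e).2 he,
      TensorPowerNorms.tendsto_normInjToHilbert_rpow φ e⟩
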